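/- For $x\in\mathbb R$ write $\langle x\rangle=(1+x^2)^{1/2}$. For $s,r\ge 0$ let $$\Sigma^{s,r}=H^s(\mathbb R)\cap L^2(\langle x\rangle^{2r}dx)\subset L^2(\mathbb R)$$ (complex-valued functions), normed by $\|u\|_{\Sigma^{s,r}}=\|u\|_{H^s}+\|u\|_{L^2(\langle x\rangle^{2r}dx)}$, where $\|u\|_{H^s}=\|\langle\xi\rangle^s\widehat u\|_{L^2}$. For Banach spaces $A_0\subset A_1$ (continuous inclusion) and $0<\theta<1$, let $(A_0,A_1)_{\theta,2}$ denote the real interpolation space with norm $$\|u\|_{(A_0,A_1)_{\theta,2}}=\left(\int_0^\infty \Big(t^{-\theta}\inf_{u=a_0+a_1}\big(\|a_1\|_{A_1}+t\|a_0\|_{A_0}\big)\Big)^2\,\frac{dt}{t}\right)^{1/2},$$ where $a_0$ ranges over $A_0$ and $a_1$ over $A_1$, and the space consists of the $u\in A_1$ for which this is finite. (This is the convention in which $\theta$ is the weight of $A_0$, so that $(H^s(\mathbb R),L^2(\mathbb R))_{\theta,2}=H^{s\theta}(\mathbb R)$; in the opposite convention the same space is denoted $(A_0,A_1)_{1-\theta,2}$.)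 **Proposition.** For all $0<\theta<1$, $k\in\mathbb N=\{0,1,2,\dots\}$ and $r>0$, $$\big(\Sigma^{k,r},L^2(\mathbb R)\big)_{\theta,2}=\Sigma^{k\theta,r\theta},$$ as subsets of $L^2(\mathbb R)$ and with equivalent norms: there are constants $0<c\le C<\infty$, depending only on $\theta,k,r$, such that $c\|u\|_{\Sigma^{k\theta,r\theta}}\le\|u\|_{(\Sigma^{k,r},L^2)_{\theta,2}}\le C\|u\|_{\Sigma^{k\theta,r\theta}}$ for all $u\in\Sigma^{k\theta,r\theta}$. -/

import Mathlib

open MeasureTheory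
open scoped ENNReal NNReal FourierTransform SchwartzMap

noncomputable section

/-! ### Real interpolation (K-method)

A Banach space continuously embedded in an ambient vector space `V` is described by its
norm, extended by the value `∞` outside of the space. -/

/-- The K-functional of the couple `(A₀, A₁)` of subspaces of `V` with extended norms `N₀`, `N₁`:
`K(t, u; A₀, A₁) = inf {‖a₀‖_{A₀} + t ‖a₁‖_{A₁} : u = a₀ + a₁}`. -/
def kFunctional {V : Type*} [AddCommGroup V] (N₀ N₁ : V → ℝ≥0∞) (t : ℝ) (u : V) : ℝ≥0∞ :=
  ⨅ (a₀ : V) (a₁ : V) (_ : u = a₀ + a₁), N₀ a₀ + ENNReal.ofReal t * N₁ a₁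

/-- The extended norm of the real interpolation space `(A₀, A₁)_{θ,q}`, `0 < θ < 1`, `1 ≤ q < ∞`,
in the convention in which `θ` is the weight of `A₀` (so that
`‖u‖_{θ,q} ≤ C ‖u‖_{A₀} ^ θ ‖u‖_{A₁} ^ (1 - θ)`, and `(H^s, L²)_{θ,2} = H^{sθ}`):
`‖u‖_{θ,q} = (∫₀^∞ (t ^ (-θ) K(t, u; A₁, A₀)) ^ q dt / t) ^ (1/q)`.
Since `K(t, u; A₁, A₀) = t K(1/t, u; A₀, A₁)`, this is the same as
`(∫₀^∞ (t ^ (-(1 - θ)) K(t, u; A₀, A₁)) ^ q dt / t) ^ (1/q)`. -/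
def realInterpENorm {V : Type*} [AddCommGroup V] (N₀ N₁ : V → ℝ≥0∞) (θ q : ℝ) (u : V) : ℝ≥0∞ :=
  (∫⁻ t in Set.Ioi (0 : ℝ),
    (ENNReal.ofReal (t ^ (-θ)) * kFunctional N₁ N₀ t u) ^ q * ENNReal.ofReal t⁻¹) ^ (1 / q)

/-- The real interpolation space `(A₀, A₁)_{θ,q}` (same convention). -/
def realInterpSpace {V : Type*} [AddCommGroup V] (N₀ N₁ : V → ℝ≥0∞) (θ q : ℝ) : Set V :=
  {u | realInterpENorm N₀ N₁ θ q u < ∞}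

/-! ### The spaces `Σ^{s,r} = H^s(ℝ) ∩ L²(⟨x⟩^{2r} dx)` -/

/-- The complex Hilbert space `L²(ℝ)`. -/
abbrev L2R : Type := Lp ℂ 2 (volume : Measure ℝ)

/-- `⟨x⟩ = (1 + x²)^{1/2}`. -/
def japaneseBracket (x : ℝ) : ℝ := √(1 + x ^ 2)

/-- The measure `⟨x⟩^{2r} dx` on `ℝ`. -/
def bracketMeasure (r : ℝ) : Measure ℝ :=
  volume.withDensity fun x => ENNReal.ofReal (japaneseBracket x ^ (2 * r))

/-- The extended norm of `L²(ℝ)`. -/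
def lTwoENorm (u : L2R) : ℝ≥0∞ := eLpNorm u 2 volume

/-- The extended norm of `L²(⟨x⟩^{2r} dx)`. -/
def weightedENorm (r : ℝ) (u : L2R) : ℝ≥0∞ := eLpNorm u 2 (bracketMeasure r)

/-- The extended norm of `H^s(ℝ)`: the norm of `⟨ξ⟩^s û(ξ)` in `L²(dξ)`, with `û = 𝓕 u` the
Fourier-Plancherel transform. -/
def sobolevENorm (s : ℝ) (u : L2R) : ℝ≥0∞ :=
  eLpNorm (𝓕 u : L2R) 2 (bracketMeasure s)

/-- The extended norm of `Σ^{s,r} = H^s(ℝ) ∩ L²(⟨x⟩^{2r} dx)`. -/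
def sigmaENorm (s r : ℝ) (u : L2R) : ℝ≥0∞ := sobolevENorm s u + weightedENorm r u

/-- The space `Σ^{s,r} = H^s(ℝ) ∩ L²(⟨x⟩^{2r} dx)`, for `s, r ≥ 0`, as a subset of `L²(ℝ)`. -/
def sigmaSpace (s r : ℝ) : Set L2R :=
  {u | TemperedDistribution.MemSobolev s 2 (u : 𝓢'(ℝ, ℂ)) ∧ MemLp u 2 (bracketMeasure r)}

/-! ### Consistency: the extended norms above are finite exactly on the respective spaces -/

lemma eLpNorm_bracketMeasure (s : ℝ) (g : ℝ → ℂ) (hg : AEStronglyMeasurable g volume) :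
    eLpNorm g 2 (bracketMeasure s) =
      eLpNorm (fun x : ℝ => (((1 + ‖x‖ ^ 2) ^ (s / 2) : ℝ) : ℂ) * g x) 2 volume := by
  have hm : Measurable fun x : ℝ => ENNReal.ofReal (japaneseBracket x ^ (2 * s)) := by
    unfold japaneseBracket; fun_prop
  rw [eLpNorm_eq_lintegral_rpow_enorm_toReal (by norm_num) (by norm_num),
    eLpNorm_eq_lintegral_rpow_enorm_toReal (by norm_num) (by norm_num), bracketMeasure,
    lintegral_withDensity_eq_lintegral_mul₀ hm.aemeasurable (by fun_prop)]
  congr 1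
  refine lintegral_congr fun x => ?_
  have h1 : (0 : ℝ) < 1 + ‖x‖ ^ 2 := by positivity
  have h2 : japaneseBracket x ^ (2 * s) = ((1 + ‖x‖ ^ 2) ^ (s / 2)) ^ (2 : ℝ) := by
    rw [japaneseBracket, Real.sqrt_eq_rpow, ← Real.rpow_mul (by positivity),
      ← Real.rpow_mul h1.le, Real.norm_eq_abs, sq_abs]
    congr 1; ring
  simp only [Pi.mul_apply, ENNReal.toReal_ofNat]
  rw [enorm_mul, ENNReal.mul_rpow_of_nonneg _ _ (by norm_num), h2,
    ← ENNReal.ofReal_rpow_of_nonneg (by positivity) (by norm_num)]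
  congr 2
  have h3 : (0 : ℝ) ≤ (1 + ‖x‖ ^ 2) ^ (s / 2) := Real.rpow_nonneg h1.le _
  rw [← ofReal_norm, Complex.norm_real, Real.norm_of_nonneg h3]

lemma memSobolev_iff_sobolevENorm_lt_top (s : ℝ) (u : L2R) :
    TemperedDistribution.MemSobolev s 2 (u : 𝓢'(ℝ, ℂ)) ↔ sobolevENorm s u < ∞ := by
  have hw : (fun x : ℝ => (((1 + ‖x‖ ^ 2) ^ (s / 2) : ℝ) : ℂ)).HasTemperateGrowth := by
    fun_prop
  have hc : Continuous fun x : ℝ => (((1 + ‖x‖ ^ 2) ^ (s / 2) : ℝ) : ℂ) := by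
    refine Complex.continuous_ofReal.comp (Continuous.rpow_const (by fun_prop) fun x => ?_)
    left; positivity
  have hmeas : AEStronglyMeasurable
      (fun x : ℝ => (((1 + ‖x‖ ^ 2) ^ (s / 2) : ℝ) : ℂ) * (𝓕 u : L2R) x) volume :=
    hc.aestronglyMeasurable.mul (Lp.aestronglyMeasurable _)
  rw [TemperedDistribution.memSobolev_iff_exists_smulLeftCLM_fourier,
    Lp.fourier_toTemperedDistribution_eq, sobolevENorm,
    eLpNorm_bracketMeasure s _ (Lp.aestronglyMeasurable _)]
  constructor
  · rintro ⟨f', hf'⟩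
    have hloc : LocallyIntegrable
        (fun x : ℝ => (((1 + ‖x‖ ^ 2) ^ (s / 2) : ℝ) : ℂ) * (𝓕 u : L2R) x) volume := by
      have h := ((Lp.memLp (𝓕 u : L2R)).locallyIntegrable (by norm_num)).locallyIntegrableOn
        Set.univ
      exact locallyIntegrableOn_univ.1
        (h.continuousOn_mul hc.continuousOn isClosed_univ.isLocallyClosed)
    have hae : (fun x : ℝ => (((1 + ‖x‖ ^ 2) ^ (s / 2) : ℝ) : ℂ) * (𝓕 u : L2R) x)
        =ᵐ[volume] f' := by
      refine ae_eq_of_integral_contDiff_smul_eq hloc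
        ((Lp.memLp f').locallyIntegrable (by norm_num)) fun g g_smooth g_cpt => ?_
      have hg₁ : HasCompactSupport (Complex.ofRealCLM ∘ g) := g_cpt.comp_left rfl
      have hg₂ : ContDiff ℝ (⊤ : ℕ∞) (Complex.ofRealCLM ∘ g) := by fun_prop
      have h := DFunLike.congr_fun hf' (hg₁.toSchwartzMap hg₂)
      rw [TemperedDistribution.smulLeftCLM_apply_apply, Lp.toTemperedDistribution_apply,
        Lp.toTemperedDistribution_apply] at h
      simp only [SchwartzMap.smulLeftCLM_apply_apply hw] at h
      refine Eq.trans (integral_congr_ae (.of_forall fun x => ?_))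
        (h.trans (integral_congr_ae (.of_forall fun x => ?_)))
      · simp; ring
      · simp
    rw [eLpNorm_congr_ae hae]
    exact Lp.eLpNorm_lt_top f'
  · intro h
    have hmem : MemLp (fun x : ℝ => (((1 + ‖x‖ ^ 2) ^ (s / 2) : ℝ) : ℂ) * (𝓕 u : L2R) x) 2
        volume := ⟨hmeas, h⟩
    refine ⟨hmem.toLp _, ?_⟩
    ext φ
    rw [TemperedDistribution.smulLeftCLM_apply_apply, Lp.toTemperedDistribution_apply,
      Lp.toTemperedDistribution_apply]
    simp only [SchwartzMap.smulLeftCLM_apply_apply hw]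
    refine integral_congr_ae ?_
    filter_upwards [hmem.coeFn_toLp] with x hx
    rw [hx]
    simp; ring

lemma mem_sigmaSpace_iff (s r : ℝ) (u : L2R) : u ∈ sigmaSpace s r ↔ sigmaENorm s r u < ∞ := by
  have hac : bracketMeasure r ≪ volume := withDensity_absolutelyContinuous _ _
  have h : MemLp u 2 (bracketMeasure r) ↔ weightedENorm r u < ∞ :=
    ⟨fun h => h.2, fun h => ⟨(Lp.aestronglyMeasurable u).mono_ac hac, h⟩⟩
  simp only [sigmaSpace, Set.mem_ofPred_eq, memSobolev_iff_sobolevENorm_lt_top, h, sigmaENorm,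
    ENNReal.add_lt_top]

end

/-! ### The Japanese bracket -/

/-! For one weight `⟨x⟩^s`, the K-functional of `L²` and `L²(⟨x⟩^{2s} dx)` is comparable to the `L²`
norm of `min(1, t⟨x⟩^s) g`. Since `∫₀^∞ t^{-2θ} min(1, tW)² dt/t` is a constant times `W^{2θ}`,
Tonelli turns these truncated norms exactly into the norm with weight exponent `sθ`
(`interpENorm_truncENorm`).

Lower bound: the `Σ^{s,r}` norm dominates both the `H^s` norm and the weighted norm, so the
K-functional dominates the truncated norms of `û` and of `u` (`truncENorm_le_kFunctional`).

Upper bound: a single decomposition of `u` must serve frequency and space at once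
(`kFunctional_sigmaENorm_le`). For `t < 1`, let `v` be `u` cut sharply to the frequencies with
`t⟨ξ⟩^s ≤ 1`, and set `a(x) = p(t^{1/r} x) v(x)` with `p` a smooth cutoff. The frequency cutoff
controls `v` in `H^s` and `u - v` in `L²`. Multiplication by the dilated cutoff is bounded on `H^s`
uniformly in `t` (`sobolevMulConst_schwartzDilation_le`), while `t⟨x⟩^r` is bounded on its support,
so the weighted norm of `a` needs `v` only through `u` and the `L²` norm of `u - v`. The argument
works for every real `s ≥ 0`. -/

lemma one_le_japaneseBracket (x : ℝ) : 1 ≤ japaneseBracket x :=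
  Real.one_le_sqrt.2 (by nlinarith [sq_nonneg x])

lemma japaneseBracket_pos (x : ℝ) : 0 < japaneseBracket x :=
  zero_lt_one.trans_le (one_le_japaneseBracket x)

lemma continuous_japaneseBracket : Continuous japaneseBracket := by
  unfold japaneseBracket; fun_prop

lemma continuous_japaneseBracket_rpow (s : ℝ) : Continuous fun x => japaneseBracket x ^ s :=
  continuous_japaneseBracket.rpow_const fun x => Or.inl (japaneseBracket_pos x).ne'

lemma one_le_japaneseBracket_rpow {s : ℝ} (hs : 0 ≤ s) (x : ℝ) : 1 ≤ japaneseBracket x ^ s :=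
  Real.one_le_rpow (one_le_japaneseBracket x) hs

lemma japaneseBracket_rpow_eq (s x : ℝ) : japaneseBracket x ^ s = (1 + ‖x‖ ^ 2) ^ (s / 2) := by
  rw [japaneseBracket, Real.sqrt_eq_rpow, ← Real.rpow_mul (by positivity), Real.norm_eq_abs,
    sq_abs]
  congr 1; ring

lemma japaneseBracket_le_of_abs_le {x y : ℝ} (h : |x| ≤ |y|) :
    japaneseBracket x ≤ japaneseBracket y :=
  Real.sqrt_le_sqrt (by linarith [sq_le_sq.2 h])

/-- This submultiplicativity lets the weight be distributed over the two factors of a convolution.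
-/
lemma japaneseBracket_add_le (x y : ℝ) :
    japaneseBracket (x + y) ≤ √2 * (japaneseBracket x * japaneseBracket y) := by
  unfold japaneseBracket
  rw [← Real.sqrt_mul (by positivity), ← Real.sqrt_mul (by positivity)]
  apply Real.sqrt_le_sqrt
  nlinarith [sq_nonneg (x - y), sq_nonneg (x * y)]

lemma japaneseBracket_add_rpow_le {s : ℝ} (hs : 0 ≤ s) (x y : ℝ) :
    japaneseBracket (x + y) ^ s ≤ √2 ^ s * (japaneseBracket x ^ s * japaneseBracket y ^ s) := by
  rw [← Real.mul_rpow (japaneseBracket_pos x).le (japaneseBracket_pos y).le,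
    ← Real.mul_rpow (by positivity)
      (mul_nonneg (japaneseBracket_pos x).le (japaneseBracket_pos y).le)]
  exact Real.rpow_le_rpow (japaneseBracket_pos _).le (japaneseBracket_add_le x y) hs

/-! ### Weighted `L²` norms -/

lemma bracketMeasure_absolutelyContinuous (s : ℝ) : bracketMeasure s ≪ volume :=
  withDensity_absolutelyContinuous _ _

lemma eLpNorm_bracketMeasure_eq_smul (s : ℝ) (g : ℝ → ℂ) (hg : AEStronglyMeasurable g volume) :
    eLpNorm g 2 (bracketMeasure s) =
      eLpNorm (fun x => (japaneseBracket x ^ s) • g x) 2 volume := by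
  rw [eLpNorm_bracketMeasure s g hg]
  simp only [japaneseBracket_rpow_eq, Complex.real_smul]

lemma eLpNorm_two_sq {α E : Type*} [MeasurableSpace α] [NormedAddCommGroup E] (μ : Measure α)
    (g : α → E) : eLpNorm g 2 μ ^ (2 : ℝ) = ∫⁻ x, ‖g x‖ₑ ^ (2 : ℝ) ∂μ := by
  rw [eLpNorm_eq_lintegral_rpow_enorm_toReal (by norm_num) (by norm_num), ← ENNReal.rpow_mul]
  simp

lemma eLpNorm_bracketMeasure_sq (s : ℝ) (g : ℝ → ℂ) (hg : AEStronglyMeasurable g volume) :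
    eLpNorm g 2 (bracketMeasure s) ^ (2 : ℝ) =
      ∫⁻ x, (ENNReal.ofReal (japaneseBracket x ^ s) * ‖g x‖ₑ) ^ (2 : ℝ) := by
  rw [eLpNorm_bracketMeasure_eq_smul s g hg, eLpNorm_two_sq]
  refine lintegral_congr fun x => ?_
  rw [enorm_smul, Real.enorm_of_nonneg (Real.rpow_nonneg (japaneseBracket_pos x).le _)]

lemma lTwoENorm_fourier (u : L2R) : lTwoENorm (𝓕 u : L2R) = lTwoENorm u := by
  have h := Lp.norm_fourier_eq u
  rw [Lp.norm_def, Lp.norm_def] at h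
  exact (ENNReal.toReal_eq_toReal_iff' (Lp.eLpNorm_ne_top _) (Lp.eLpNorm_ne_top _)).1 h

/-! ### Young's convolution inequality `L¹ * L² → L²` -/

/-- Cauchy–Schwarz for the factorization `F G = F^{1/2} (F G²)^{1/2}`. -/
lemma lintegral_mul_sq_le {α : Type*} [MeasurableSpace α] (μ : Measure α) {F G : α → ℝ≥0∞}
    (hF : AEMeasurable F μ) (hG : AEMeasurable G μ) :
    (∫⁻ y, F y * G y ∂μ) ^ (2 : ℝ) ≤ (∫⁻ y, F y ∂μ) * ∫⁻ y, F y * G y ^ (2 : ℝ) ∂μ := by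
  have h := ENNReal.lintegral_mul_norm_pow_le (μ := μ) (f := F)
    (g := fun y => F y * G y ^ (2 : ℝ)) (p := 1 / 2) (q := 1 / 2) hF (by fun_prop)
    (by norm_num) (by norm_num) (by norm_num)
  have h1 : ∀ y, F y ^ (1 / 2 : ℝ) * (F y * G y ^ (2 : ℝ)) ^ (1 / 2 : ℝ) = F y * G y := by
    intro y
    rw [ENNReal.mul_rpow_of_nonneg _ _ (by norm_num), ← ENNReal.rpow_mul, ← mul_assoc,
      ← ENNReal.rpow_add_of_nonneg _ _ (by norm_num) (by norm_num)]
    norm_num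
  simp only [h1] at h
  have h2 := ENNReal.rpow_le_rpow h (z := 2) (by norm_num)
  rw [← ENNReal.mul_rpow_of_nonneg _ _ (by norm_num), ← ENNReal.rpow_mul] at h2
  simpa using h2

lemma lintegral_convolution_sq_le {F G : ℝ → ℝ≥0∞} (hF : Measurable F) (hG : Measurable G) :
    ∫⁻ x, (∫⁻ y, F y * G (x - y)) ^ (2 : ℝ) ≤ (∫⁻ y, F y) ^ (2 : ℝ) * ∫⁻ x, G x ^ (2 : ℝ) := by
  calc
    _ ≤ ∫⁻ x, (∫⁻ y, F y) * ∫⁻ y, F y * G (x - y) ^ (2 : ℝ) :=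
      lintegral_mono fun x => lintegral_mul_sq_le volume hF.aemeasurable (by fun_prop)
    _ = (∫⁻ y, F y) * ∫⁻ x, ∫⁻ y, F y * G (x - y) ^ (2 : ℝ) := by
      refine lintegral_const_mul _ (Measurable.lintegral_prod_right' (f := fun z : ℝ × ℝ =>
        F z.2 * G (z.1 - z.2) ^ (2 : ℝ)) ?_)
      fun_prop
    _ = (∫⁻ y, F y) * ∫⁻ y, ∫⁻ x, F y * G (x - y) ^ (2 : ℝ) := by
      rw [lintegral_lintegral_swap]
      exact Measurable.aemeasurable (by fun_prop)
    _ = (∫⁻ y, F y) * ∫⁻ y, F y * ∫⁻ x, G x ^ (2 : ℝ) := by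
      congr 1
      refine lintegral_congr fun y => ?_
      rw [lintegral_const_mul _ (by fun_prop),
        lintegral_sub_right_eq_self (fun x => G x ^ (2 : ℝ)) y]
    _ = _ := by
      rw [lintegral_mul_const _ hF, ← mul_assoc, ENNReal.rpow_two, sq]

/-! ### Multiplication of Schwartz functions in weighted norms -/

/-- The constant in the bound of multiplication by `p` on `H^s(ℝ)`. -/
noncomputable def sobolevMulConst (s : ℝ) (p : 𝓢(ℝ, ℂ)) : ℝ≥0∞ :=
  ENNReal.ofReal (√2 ^ s) * ∫⁻ x, ENNReal.ofReal (japaneseBracket x ^ s) * ‖(𝓕 p) x‖ₑ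

/-- The transform of a product is the convolution of the transforms. This follows from the
convolution theorem applied to `𝓕⁻ p` and `𝓕⁻ h`, then reflecting by `(𝓕⁻ q)(y) = (𝓕 q)(-y)`. -/
lemma enorm_fourier_pairing_le (p h : 𝓢(ℝ, ℂ)) (x : ℝ) :
    ‖(𝓕 (SchwartzMap.pairing (ContinuousLinearMap.mul ℂ ℂ) p h)) x‖ₑ ≤
      ∫⁻ y, ‖(𝓕 p) y‖ₑ * ‖(𝓕 h) (x - y)‖ₑ := by
  have key : SchwartzMap.convolution (ContinuousLinearMap.mul ℂ ℂ) (𝓕⁻ p) (𝓕⁻ h) =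
      𝓕⁻ (SchwartzMap.pairing (ContinuousLinearMap.mul ℂ ℂ) p h) := by
    have h := SchwartzMap.fourier_convolution (ContinuousLinearMap.mul ℂ ℂ) (𝓕⁻ p) (𝓕⁻ h)
    rw [FourierTransform.fourier_fourierInv_eq, FourierTransform.fourier_fourierInv_eq] at h
    rw [← h, FourierTransform.fourierInv_fourier_eq]
  have e : ∀ q : 𝓢(ℝ, ℂ), ∀ y, (𝓕⁻ q) y = (𝓕 q) (-y) := fun q y => by
    rw [SchwartzMap.fourierInv_apply_eq]; rfl
  have h1 := congrArg (fun q : 𝓢(ℝ, ℂ) => q (-x)) key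
  simp only [e, neg_neg] at h1
  rw [← h1, SchwartzMap.convolution_apply]
  refine (enorm_integral_le_lintegral_enorm _).trans_eq ?_
  refine Eq.trans (lintegral_congr fun y => ?_)
    (lintegral_neg_eq_self fun y => ‖(𝓕 p) y‖ₑ * ‖(𝓕 h) (x - y)‖ₑ)
  rw [ContinuousLinearMap.mul_apply', enorm_mul, e, e]
  congr 3
  ring

/-- Splitting `⟨x⟩^s` over `y` and `x - y` reduces this to Young's inequality for the weighted
transforms. -/
lemma eLpNorm_fourier_pairing_le {s : ℝ} (hs : 0 ≤ s) (p h : 𝓢(ℝ, ℂ)) :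
    eLpNorm (𝓕 (SchwartzMap.pairing (ContinuousLinearMap.mul ℂ ℂ) p h) : 𝓢(ℝ, ℂ)) 2
        (bracketMeasure s) ≤
      sobolevMulConst s p * eLpNorm (𝓕 h : 𝓢(ℝ, ℂ)) 2 (bracketMeasure s) := by
  have hw : Measurable fun x => ENNReal.ofReal (japaneseBracket x ^ s) :=
    (continuous_japaneseBracket_rpow s).measurable.ennreal_ofReal
  have hm : ∀ q : 𝓢(ℝ, ℂ), Measurable fun x => ENNReal.ofReal (japaneseBracket x ^ s) * ‖q x‖ₑ :=
    fun q => hw.mul q.continuous.measurable.enorm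
  rw [← ENNReal.rpow_le_rpow_iff (z := 2) (by norm_num), ENNReal.mul_rpow_of_nonneg _ _ (by norm_num),
    eLpNorm_bracketMeasure_sq _ _ (SchwartzMap.continuous _).aestronglyMeasurable,
    eLpNorm_bracketMeasure_sq _ _ (SchwartzMap.continuous _).aestronglyMeasurable,
    sobolevMulConst, ENNReal.mul_rpow_of_nonneg _ _ (by norm_num), mul_assoc]
  refine le_trans ?_ (mul_le_mul_right (lintegral_convolution_sq_le (hm (𝓕 p)) (hm (𝓕 h))) _)
  rw [← lintegral_const_mul' _ _ (ENNReal.rpow_ne_top_of_nonneg (by norm_num) ENNReal.ofReal_ne_top)]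
  refine lintegral_mono fun x => ?_
  rw [← ENNReal.mul_rpow_of_nonneg _ _ (by norm_num)]
  refine ENNReal.rpow_le_rpow ?_ (by norm_num)
  refine (mul_le_mul_right (enorm_fourier_pairing_le p h x) _).trans ?_
  rw [← lintegral_const_mul' _ _ ENNReal.ofReal_ne_top,
    ← lintegral_const_mul' _ _ ENNReal.ofReal_ne_top]
  refine lintegral_mono fun y => ?_
  have h1 := japaneseBracket_add_rpow_le hs y (x - y)
  rw [add_sub_cancel] at h1
  have h2 := ENNReal.ofReal_le_ofReal h1
  have n := fun x => Real.rpow_nonneg (japaneseBracket_pos x).le s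
  rw [ENNReal.ofReal_mul (by positivity), ENNReal.ofReal_mul (n _)] at h2
  refine (mul_le_mul_left h2 _).trans_eq ?_
  ring

/-! ### Multiplication by Schwartz functions on `H^s(ℝ)` -/

lemma hasTemperateGrowth_japaneseBracket_rpow (s : ℝ) :
    (fun x : ℝ => japaneseBracket x ^ s).HasTemperateGrowth := by
  simp only [japaneseBracket_rpow_eq]
  fun_prop

lemma integrable_japaneseBracket_rpow_mul_norm (s : ℝ) (p : 𝓢(ℝ, ℂ)) :
    Integrable fun x => japaneseBracket x ^ s * ‖p x‖ := by
  refine (SchwartzMap.integrable (SchwartzMap.smulLeftCLM ℂ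
    (fun x : ℝ => japaneseBracket x ^ s) p)).norm.congr (.of_forall fun x => ?_)
  simp only [SchwartzMap.smulLeftCLM_apply_apply (hasTemperateGrowth_japaneseBracket_rpow s),
    norm_smul]
  rw [Real.norm_of_nonneg (Real.rpow_nonneg (japaneseBracket_pos x).le _)]

/-- Shows that the constant is finite, and allows a change of variables in the Bochner integral. -/
lemma sobolevMulConst_eq (s : ℝ) (p : 𝓢(ℝ, ℂ)) :
    sobolevMulConst s p =
      ENNReal.ofReal (√2 ^ s * ∫ x, japaneseBracket x ^ s * ‖(𝓕 p : 𝓢(ℝ, ℂ)) x‖) := by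
  have n := fun x => Real.rpow_nonneg (japaneseBracket_pos x).le s
  rw [sobolevMulConst, ENNReal.ofReal_mul (by positivity),
    ofReal_integral_eq_lintegral_ofReal (integrable_japaneseBracket_rpow_mul_norm s _)
      (.of_forall fun x => mul_nonneg (n x) (norm_nonneg _))]
  congr 1
  refine lintegral_congr fun x => ?_
  rw [ENNReal.ofReal_mul (n x), ofReal_norm]

/-- Fatou along an almost everywhere convergent subsequence: weighted norms are lower
semicontinuous, though not continuous in general, under `L²` convergence. -/
lemma eLpNorm_le_of_tendsto_of_absolutelyContinuous {μ : Measure ℝ} (hμ : μ ≪ volume)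
    {f : ℕ → L2R} {g : L2R} (hf : Filter.Tendsto f Filter.atTop (nhds g)) {c : ℕ → ℝ≥0∞}
    {C : ℝ≥0∞} (hc : Filter.Tendsto c Filter.atTop (nhds C))
    (h : ∀ n, eLpNorm (f n) 2 μ ≤ c n) : eLpNorm g 2 μ ≤ C := by
  obtain ⟨φ, hφ, hae⟩ := (tendstoInMeasure_of_tendsto_Lp hf).exists_seq_tendsto_ae
  calc eLpNorm g 2 μ ≤ Filter.atTop.liminf fun n => eLpNorm (f (φ n)) 2 μ :=
        Lp.eLpNorm_lim_le_liminf_eLpNorm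
          (fun n => (Lp.aestronglyMeasurable (f (φ n))).mono_ac hμ) _ (hμ.ae_le hae)
    _ ≤ Filter.atTop.liminf fun n => c (φ n) :=
        Filter.liminf_le_liminf (.of_forall fun n => h (φ n))
    _ = C := (hc.comp hφ.tendsto_atTop).liminf_eq

lemma sobolevENorm_toLp (s : ℝ) (g : 𝓢(ℝ, ℂ)) :
    sobolevENorm s (g.toLp 2) = eLpNorm (𝓕 g : 𝓢(ℝ, ℂ)) 2 (bracketMeasure s) := by
  rw [sobolevENorm, SchwartzMap.toLp_fourier_eq]
  exact eLpNorm_congr_ae ((bracketMeasure_absolutelyContinuous s).ae_le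
    (SchwartzMap.coeFn_toLp _ 2 volume))

/-- Schwartz functions approximate the elements of `H^s(ℝ)`. -/
lemma exists_schwartz_tendsto_sobolevENorm {s : ℝ} (hs : 0 ≤ s) {v : L2R}
    (hv : sobolevENorm s v ≠ ∞) :
    ∃ g : ℕ → 𝓢(ℝ, ℂ), Filter.Tendsto (fun n => (g n).toLp 2) Filter.atTop (nhds v) ∧
      Filter.Tendsto (fun n => sobolevENorm s ((g n).toLp 2)) Filter.atTop
        (nhds (sobolevENorm s v)) := by
  have hmem : MemLp (fun x => (japaneseBracket x ^ s) • (𝓕 v : L2R) x) 2 volume := by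
    refine ⟨(continuous_japaneseBracket_rpow s).aestronglyMeasurable.smul
      (Lp.aestronglyMeasurable _), ?_⟩
    rw [← eLpNorm_bracketMeasure_eq_smul s _ (Lp.aestronglyMeasurable _)]
    exact hv.lt_top
  have hne : sobolevENorm s v = eLpNorm (hmem.toLp _) 2 volume := by
    rw [sobolevENorm, eLpNorm_bracketMeasure_eq_smul s _ (Lp.aestronglyMeasurable _)]
    exact eLpNorm_congr_ae hmem.coeFn_toLp.symm
  -- Approximate `⟨ξ⟩^s v̂` in `L²` by Schwartz functions, then divide by the weight. Since
  -- `⟨ξ⟩^{-s} ≤ 1`, plain `L²` convergence is inherited.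
  obtain ⟨y, hy, hlim⟩ := mem_closure_iff_seq_limit.1
    ((SchwartzMap.denseRange_toLpCLM (E := ℝ) (F := ℂ) (p := 2) (μ := volume) (by norm_num))
      (hmem.toLp _))
  choose h hh using hy
  simp only [SchwartzMap.toLpCLM_apply] at hh
  have hw := hasTemperateGrowth_japaneseBracket_rpow (-s)
  have cancel : ∀ x, japaneseBracket x ^ s * japaneseBracket x ^ (-s) = 1 := fun x => by
    rw [← Real.rpow_add (japaneseBracket_pos x), add_neg_cancel, Real.rpow_zero]
  set g : ℕ → 𝓢(ℝ, ℂ) := fun n =>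
    𝓕⁻ (SchwartzMap.smulLeftCLM ℂ (fun x : ℝ => japaneseBracket x ^ (-s)) (h n)) with hg
  have hFg : ∀ n x, (𝓕 (g n) : 𝓢(ℝ, ℂ)) x = (japaneseBracket x ^ (-s)) • h n x := fun n x => by
    rw [hg, FourierTransform.fourier_fourierInv_eq, SchwartzMap.smulLeftCLM_apply_apply hw]
  refine ⟨g, ?_, ?_⟩
  · rw [tendsto_iff_norm_sub_tendsto_zero] at hlim ⊢
    refine squeeze_zero (fun n => norm_nonneg _) (fun n => ?_) hlim
    have hsub : (𝓕 ((g n).toLp 2 volume - v : L2R) : L2R) = 𝓕 ((g n).toLp 2 volume : L2R) - 𝓕 v :=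
      map_sub (Lp.fourierTransformₗᵢ ℝ ℂ) _ _
    rw [← Lp.norm_fourier_eq, hsub, SchwartzMap.toLp_fourier_eq, ← hh]
    refine Lp.norm_le_norm_of_ae_le ?_
    filter_upwards [Lp.coeFn_sub ((𝓕 (g n) : 𝓢(ℝ, ℂ)).toLp 2) (𝓕 v : L2R),
      Lp.coeFn_sub ((h n).toLp 2) (hmem.toLp _), (𝓕 (g n) : 𝓢(ℝ, ℂ)).coeFn_toLp 2,
      (h n).coeFn_toLp 2, hmem.coeFn_toLp] with x h1 h2 h3 h4 h5
    rw [h1, h2, Pi.sub_apply, Pi.sub_apply, h3, h4, h5, hFg]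
    have : (japaneseBracket x ^ (-s)) • h n x - (𝓕 v : L2R) x =
        (japaneseBracket x ^ (-s)) • (h n x - (japaneseBracket x ^ s) • (𝓕 v : L2R) x) := by
      rw [smul_sub, smul_smul, mul_comm, cancel, one_smul]
    rw [this, norm_smul, Real.norm_of_nonneg (Real.rpow_nonneg (japaneseBracket_pos x).le _)]
    exact mul_le_of_le_one_left (norm_nonneg _)
      (Real.rpow_le_one_of_one_le_of_nonpos (one_le_japaneseBracket x) (by linarith))
  · have e : ∀ n, sobolevENorm s ((g n).toLp 2) = ‖y n‖ₑ := fun n => by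
      rw [sobolevENorm_toLp, eLpNorm_bracketMeasure_eq_smul s _
        (SchwartzMap.continuous _).aestronglyMeasurable, ← hh, Lp.enorm_def]
      refine eLpNorm_congr_ae ?_
      filter_upwards [(h n).coeFn_toLp 2] with x hx
      rw [hx, hFg, smul_smul, cancel, one_smul]
    simp only [e, hne, ← Lp.enorm_def]
    exact hlim.enorm

/-- Extends the bound on Schwartz functions by density and lower semicontinuity. -/
lemma sobolevENorm_mul_le {s : ℝ} (hs : 0 ≤ s) (p : 𝓢(ℝ, ℂ)) {v a : L2R}
    (ha : a =ᵐ[volume] fun x => p x * v x) (hv : sobolevENorm s v ≠ ∞) :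
    sobolevENorm s a ≤ sobolevMulConst s p * sobolevENorm s v := by
  obtain ⟨g, hg, hgs⟩ := exists_schwartz_tendsto_sobolevENorm hs hv
  set q : ℕ → 𝓢(ℝ, ℂ) := fun n => SchwartzMap.pairing (ContinuousLinearMap.mul ℂ ℂ) p (g n)
  have hq : Filter.Tendsto (fun n => (q n).toLp 2) Filter.atTop (nhds a) := by
    rw [tendsto_iff_norm_sub_tendsto_zero] at hg ⊢
    have hg' := hg.const_mul (SchwartzMap.seminorm ℝ 0 0 p)
    rw [mul_zero] at hg'
    refine squeeze_zero (fun n => norm_nonneg _) (fun n => ?_) hg'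
    refine Lp.norm_le_mul_norm_of_ae_le_mul ?_
    filter_upwards [Lp.coeFn_sub ((q n).toLp 2) a, Lp.coeFn_sub ((g n).toLp 2) v,
      (q n).coeFn_toLp 2, (g n).coeFn_toLp 2, ha] with x h1 h2 h3 h4 h5
    rw [h1, h2, Pi.sub_apply, Pi.sub_apply, h3, h4, h5]
    have : q n x = p x * g n x := rfl
    rw [this, ← mul_sub, norm_mul]
    exact mul_le_mul_of_nonneg_right (SchwartzMap.norm_le_seminorm ℝ p x) (norm_nonneg _)
  have hF : Filter.Tendsto (fun n => (𝓕 ((q n).toLp 2 : L2R) : L2R)) Filter.atTop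
      (nhds (𝓕 a : L2R)) :=
    ((FourierTransform.continuous_fourier (E := L2R) (F := L2R)).tendsto a).comp hq
  refine eLpNorm_le_of_tendsto_of_absolutelyContinuous (bracketMeasure_absolutelyContinuous s) hF
    (ENNReal.Tendsto.const_mul hgs (Or.inr ?_)) fun n => ?_
  · rw [sobolevMulConst_eq]; exact ENNReal.ofReal_ne_top
  · change sobolevENorm s _ ≤ _
    rw [sobolevENorm_toLp, sobolevENorm_toLp]
    exact eLpNorm_fourier_pairing_le hs p (g n)

/-! ### Rescaled Schwartz functions -/

/-- The Schwartz function `x ↦ p (δ x)`. -/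
noncomputable def schwartzDilation (p : 𝓢(ℝ, ℂ)) {δ : ℝ} (hδ : δ ≠ 0) : 𝓢(ℝ, ℂ) :=
  SchwartzMap.compCLMOfContinuousLinearEquiv ℂ
    (ContinuousLinearEquiv.smulLeft (Units.mk0 δ hδ)) p

lemma schwartzDilation_apply (p : 𝓢(ℝ, ℂ)) {δ : ℝ} (hδ : δ ≠ 0) (x : ℝ) :
    schwartzDilation p hδ x = p (δ * x) := rfl

lemma fourier_schwartzDilation (p : 𝓢(ℝ, ℂ)) {δ : ℝ} (hδ : 0 < δ) (ξ : ℝ) :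
    (𝓕 (schwartzDilation p hδ.ne') : 𝓢(ℝ, ℂ)) ξ = δ⁻¹ • (𝓕 p : 𝓢(ℝ, ℂ)) (ξ / δ) := by
  rw [SchwartzMap.fourier_coe, SchwartzMap.fourier_coe, Real.fourier_real_eq, Real.fourier_real_eq]
  have h := Measure.integral_comp_mul_left
    (fun v : ℝ => Real.fourierChar (-(v * (ξ / δ))) • p v) δ
  rw [abs_of_pos (inv_pos.2 hδ)] at h
  rw [← h]
  refine integral_congr_ae (.of_forall fun v => ?_)
  simp only [schwartzDilation_apply]
  congr 3
  field_simp

/-- Dilation preserves the `L¹` norm of the transform and, for `δ ≤ 1`, concentrates it towards the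
origin, where the weight is smaller. -/
lemma sobolevMulConst_schwartzDilation_le {s : ℝ} (hs : 0 ≤ s) (p : 𝓢(ℝ, ℂ)) {δ : ℝ}
    (hδ : 0 < δ) (hδ1 : δ ≤ 1) :
    sobolevMulConst s (schwartzDilation p hδ.ne') ≤ sobolevMulConst s p := by
  rw [sobolevMulConst_eq, sobolevMulConst_eq]
  refine ENNReal.ofReal_le_ofReal (mul_le_mul_of_nonneg_left ?_ (by positivity))
  have h := Measure.integral_comp_div
    (fun x => japaneseBracket x ^ s * ‖(𝓕 p : 𝓢(ℝ, ℂ)) x‖) δ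
  rw [abs_of_pos hδ, smul_eq_mul] at h
  have h' : ∫ x, japaneseBracket x ^ s * ‖(𝓕 p : 𝓢(ℝ, ℂ)) x‖ =
      ∫ x, δ⁻¹ * (japaneseBracket (x / δ) ^ s * ‖(𝓕 p : 𝓢(ℝ, ℂ)) (x / δ)‖) := by
    rw [integral_const_mul, h, inv_mul_cancel_left₀ hδ.ne']
  rw [h']
  refine integral_mono (integrable_japaneseBracket_rpow_mul_norm s _)
    (((integrable_japaneseBracket_rpow_mul_norm s (𝓕 p)).comp_div hδ.ne').const_mul _) fun x => ?_
  simp only [fourier_schwartzDilation p hδ, norm_smul, Real.norm_of_nonneg (inv_pos.2 hδ).le]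
  rw [mul_left_comm]
  refine mul_le_mul_of_nonneg_left (mul_le_mul_of_nonneg_right ?_ (norm_nonneg _))
    (inv_pos.2 hδ).le
  refine Real.rpow_le_rpow (japaneseBracket_pos x).le (japaneseBracket_le_of_abs_le ?_) hs
  rw [abs_div, abs_of_pos hδ]
  exact le_div_self (abs_nonneg x) hδ hδ1

/-- A smooth cutoff, equal to `1` on `[-1, 1]` and supported in `[-2, 2]`. -/
lemma exists_schwartz_cutoff : ∃ p : 𝓢(ℝ, ℂ), (∀ x, |x| ≤ 1 → p x = 1) ∧
    (∀ x, 2 ≤ |x| → p x = 0) ∧ (∀ x, ‖p x‖ ≤ 1) ∧ ∀ x, ‖1 - p x‖ ≤ 1 := by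
  let b : ContDiffBump (0 : ℝ) := ⟨1, 2, one_pos, one_lt_two⟩
  have h₁ : HasCompactSupport (Complex.ofRealCLM ∘ b) := b.hasCompactSupport.comp_left rfl
  have h₂ : ContDiff ℝ (⊤ : ℕ∞) (Complex.ofRealCLM ∘ b) :=
    Complex.ofRealCLM.contDiff.comp b.contDiff
  have hb : ∀ x, h₁.toSchwartzMap h₂ x = ((b x : ℝ) : ℂ) := fun x => rfl
  refine ⟨h₁.toSchwartzMap h₂, fun x hx => ?_, fun x hx => ?_, fun x => ?_, fun x => ?_⟩
  · rw [hb, b.one_of_mem_closedBall (by simpa [b] using hx), Complex.ofReal_one]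
  · rw [hb, b.zero_of_le_dist (by simpa [b] using hx), Complex.ofReal_zero]
  · rw [hb, Complex.norm_real, Real.norm_of_nonneg b.nonneg]
    exact b.le_one
  · rw [hb, ← Complex.ofReal_one, ← Complex.ofReal_sub, Complex.norm_real,
      Real.norm_of_nonneg (sub_nonneg.2 b.le_one)]
    linarith [b.nonneg (x := x)]

/-! ### The `K`-functional of a couple of weighted `L²` spaces -/

/-- The norm of `min (1, t ⟨x⟩^s) g(x)` in `L²(dx)`. -/
noncomputable def truncENorm (s t : ℝ) (g : ℝ → ℂ) : ℝ≥0∞ :=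
  eLpNorm (fun x => (min 1 (t * japaneseBracket x ^ s)) • g x) 2 volume

lemma continuous_min_mul_japaneseBracket_rpow (s t : ℝ) :
    Continuous fun x => min 1 (t * japaneseBracket x ^ s) :=
  continuous_const.min (continuous_const.mul (continuous_japaneseBracket_rpow s))

lemma min_mul_japaneseBracket_rpow_nonneg (s : ℝ) {t : ℝ} (ht : 0 ≤ t) (x : ℝ) :
    0 ≤ min 1 (t * japaneseBracket x ^ s) :=
  le_min zero_le_one (mul_nonneg ht (Real.rpow_nonneg (japaneseBracket_pos x).le _))

lemma truncENorm_le_eLpNorm (s : ℝ) {t : ℝ} (ht : 0 ≤ t) (g : ℝ → ℂ) :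
    truncENorm s t g ≤ eLpNorm g 2 volume := by
  refine eLpNorm_mono fun x => ?_
  rw [norm_smul, Real.norm_of_nonneg (min_mul_japaneseBracket_rpow_nonneg s ht x)]
  exact mul_le_of_le_one_left (norm_nonneg _) (min_le_left _ _)

lemma truncENorm_le_mul_eLpNorm (s : ℝ) {t : ℝ} (ht : 0 ≤ t) (g : ℝ → ℂ)
    (hg : AEStronglyMeasurable g volume) :
    truncENorm s t g ≤ ENNReal.ofReal t * eLpNorm g 2 (bracketMeasure s) := by
  rw [eLpNorm_bracketMeasure_eq_smul s g hg, ← Real.enorm_of_nonneg ht, ← eLpNorm_const_smul]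
  refine eLpNorm_mono fun x => ?_
  rw [Pi.smul_apply, smul_smul, norm_smul, norm_smul,
    Real.norm_of_nonneg (min_mul_japaneseBracket_rpow_nonneg s ht x)]
  exact mul_le_mul_of_nonneg_right ((min_le_right _ _).trans (le_abs_self _)) (norm_nonneg _)

/-- Bound the factor `min(1, t⟨x⟩^s)` by `1` on the `L²` piece and by `t⟨x⟩^s` on the other. It is
used with `T` the Fourier transform and with `T` the identity. -/
lemma truncENorm_le_kFunctional {s t : ℝ} (ht : 0 ≤ t) (T : L2R →ₗ[ℂ] L2R)
    (hT : ∀ u, lTwoENorm (T u) = lTwoENorm u) {N : L2R → ℝ≥0∞}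
    (hN : ∀ u, eLpNorm (T u) 2 (bracketMeasure s) ≤ N u) (u : L2R) :
    truncENorm s t (T u) ≤ kFunctional lTwoENorm N t u := by
  refine le_iInf fun b => le_iInf fun a => le_iInf fun h => ?_
  have hm := (continuous_min_mul_japaneseBracket_rpow s t).aestronglyMeasurable
    (μ := (volume : Measure ℝ))
  calc truncENorm s t (T u)
      = eLpNorm ((fun x => (min 1 (t * japaneseBracket x ^ s)) • T b x) +
          fun x => (min 1 (t * japaneseBracket x ^ s)) • T a x) 2 volume := by
        refine eLpNorm_congr_ae ?_
        rw [h, map_add]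
        filter_upwards [Lp.coeFn_add (T b) (T a)] with x hx
        rw [hx, Pi.add_apply, Pi.add_apply, smul_add]
    _ ≤ truncENorm s t (T b) + truncENorm s t (T a) :=
        eLpNorm_add_le (hm.smul (Lp.aestronglyMeasurable _)) (hm.smul (Lp.aestronglyMeasurable _))
          (by norm_num)
    _ ≤ lTwoENorm b + ENNReal.ofReal t * N a := by
        refine add_le_add ((truncENorm_le_eLpNorm s ht _).trans (hT b).le) ?_
        exact (truncENorm_le_mul_eLpNorm s ht _ (Lp.aestronglyMeasurable _)).trans
          (mul_le_mul_right (hN a) _)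

/-! ### Integration in the interpolation parameter -/

lemma lintegral_Ioc_rpow {a c : ℝ} (ha : -1 < a) (hc : 0 ≤ c) :
    ∫⁻ t in Set.Ioc 0 c, ENNReal.ofReal (t ^ a) = ENNReal.ofReal (c ^ (a + 1) / (a + 1)) := by
  rw [← ofReal_integral_eq_lintegral_ofReal]
  · rw [← intervalIntegral.integral_of_le hc, integral_rpow (Or.inl ha),
      Real.zero_rpow (by linarith), sub_zero]
  · exact (intervalIntegrable_iff_integrableOn_Ioc_of_le hc).1
      (intervalIntegral.intervalIntegrable_rpow' ha)
  · exact (ae_restrict_iff' measurableSet_Ioc).2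
      (.of_forall fun t ht => Real.rpow_nonneg ht.1.le _)

lemma lintegral_Ioi_rpow {a c : ℝ} (ha : a < -1) (hc : 0 < c) :
    ∫⁻ t in Set.Ioi c, ENNReal.ofReal (t ^ a) = ENNReal.ofReal (-c ^ (a + 1) / (a + 1)) := by
  rw [← ofReal_integral_eq_lintegral_ofReal (integrableOn_Ioi_rpow_of_lt ha hc),
    integral_Ioi_rpow_of_lt ha hc]
  exact (ae_restrict_iff' measurableSet_Ioi).2
    (.of_forall fun t ht => Real.rpow_nonneg (hc.trans ht).le _)

/-- `∫₀^∞ (t^(-θ) min (1, t))² dt / t`. -/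
noncomputable def truncConst (θ : ℝ) : ℝ := 1 / (2 - 2 * θ) + 1 / (2 * θ)

lemma truncConst_pos {θ : ℝ} (hθ₀ : 0 < θ) (hθ₁ : θ < 1) : 0 < truncConst θ :=
  add_pos (one_div_pos.2 (by linarith)) (one_div_pos.2 (by linarith))

/-- The minimum changes branch at `t = 1/W`; convergence at `0` needs `θ < 1`, at infinity `θ > 0`.
-/
lemma lintegral_rpow_min_sq {θ : ℝ} (hθ₀ : 0 < θ) (hθ₁ : θ < 1) {W : ℝ} (hW : 0 < W) :
    ∫⁻ t in Set.Ioi (0 : ℝ), (ENNReal.ofReal (t ^ (-θ)) * ENNReal.ofReal (min 1 (t * W))) ^ (2 : ℝ) *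
      ENNReal.ofReal t⁻¹ = ENNReal.ofReal (truncConst θ) * ENNReal.ofReal (W ^ θ) ^ (2 : ℝ) := by
  have hW' : 0 < W⁻¹ := inv_pos.2 hW
  have comb : ∀ t : ℝ, 0 < t → ∀ m : ℝ, 0 ≤ m →
      (ENNReal.ofReal (t ^ (-θ)) * ENNReal.ofReal m) ^ (2 : ℝ) * ENNReal.ofReal t⁻¹ =
        ENNReal.ofReal (t ^ (-2 * θ - 1) * m ^ 2) := fun t ht m hm => by
    have n := Real.rpow_nonneg ht.le (-θ)
    rw [← ENNReal.ofReal_mul n, ENNReal.ofReal_rpow_of_nonneg (mul_nonneg n hm) (by norm_num),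
      ← ENNReal.ofReal_mul (by positivity)]
    congr 1
    rw [Real.rpow_two, mul_pow, ← Real.rpow_two (t ^ (-θ)), ← Real.rpow_mul ht.le,
      Real.rpow_sub ht, Real.rpow_one]
    rw [show -θ * 2 = -2 * θ by ring]
    field_simp
  have h1 : ∫⁻ t in Set.Ioc 0 W⁻¹, (ENNReal.ofReal (t ^ (-θ)) *
      ENNReal.ofReal (min 1 (t * W))) ^ (2 : ℝ) * ENNReal.ofReal t⁻¹ =
        ENNReal.ofReal (W ^ (2 * θ) / (2 - 2 * θ)) := by
    calc _ = ∫⁻ t in Set.Ioc 0 W⁻¹, ENNReal.ofReal (W ^ 2) * ENNReal.ofReal (t ^ (1 - 2 * θ)) := by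
          refine setLIntegral_congr_fun measurableSet_Ioc fun t ht => ?_
          have h : t * W ≤ 1 := by
            calc t * W ≤ W⁻¹ * W := mul_le_mul_of_nonneg_right ht.2 hW.le
              _ = 1 := inv_mul_cancel₀ hW.ne'
          simp only [min_eq_right h]
          rw [comb t ht.1 _ (mul_nonneg ht.1.le hW.le), ← ENNReal.ofReal_mul (by positivity)]
          congr 1
          rw [show 1 - 2 * θ = (-2 * θ - 1) + 2 by ring, Real.rpow_add ht.1, Real.rpow_two]
          ring
      _ = _ := by
          rw [lintegral_const_mul' _ _ ENNReal.ofReal_ne_top,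
            lintegral_Ioc_rpow (by linarith) hW'.le, ← ENNReal.ofReal_mul (by positivity)]
          congr 1
          rw [show 1 - 2 * θ + 1 = 2 - 2 * θ by ring, Real.inv_rpow hW.le, ← Real.rpow_neg hW.le,
            ← mul_div_assoc, ← Real.rpow_two, ← Real.rpow_add hW]
          congr 2; ring
  have h2 : ∫⁻ t in Set.Ioi W⁻¹, (ENNReal.ofReal (t ^ (-θ)) *
      ENNReal.ofReal (min 1 (t * W))) ^ (2 : ℝ) * ENNReal.ofReal t⁻¹ =
        ENNReal.ofReal (W ^ (2 * θ) / (2 * θ)) := by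
    calc _ = ∫⁻ t in Set.Ioi W⁻¹, ENNReal.ofReal (t ^ (-2 * θ - 1)) := by
          refine setLIntegral_congr_fun measurableSet_Ioi fun t ht => ?_
          have h : 1 ≤ t * W := by
            calc 1 = W⁻¹ * W := (inv_mul_cancel₀ hW.ne').symm
              _ ≤ t * W := mul_le_mul_of_nonneg_right (le_of_lt ht) hW.le
          simp only [min_eq_left h]
          rw [comb t (hW'.trans ht) _ zero_le_one, one_pow, mul_one]
      _ = _ := by
          rw [lintegral_Ioi_rpow (by linarith) hW']
          congr 1
          rw [Real.inv_rpow hW.le, ← Real.rpow_neg hW.le,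
            show -(-2 * θ - 1 + 1) = 2 * θ by ring, show -2 * θ - 1 + 1 = -(2 * θ) by ring,
            neg_div_neg_eq]
  rw [← Set.Ioc_union_Ioi_eq_Ioi hW'.le, lintegral_union measurableSet_Ioi
    (Set.Ioc_disjoint_Ioi le_rfl), h1, h2,
    ENNReal.ofReal_rpow_of_nonneg (Real.rpow_nonneg hW.le _) (by norm_num),
    ← ENNReal.ofReal_mul (truncConst_pos hθ₀ hθ₁).le, ← ENNReal.ofReal_add]
  · congr 1
    rw [← Real.rpow_mul hW.le, truncConst, mul_comm θ 2]
    ring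
  · exact div_nonneg (Real.rpow_nonneg hW.le _) (by linarith)
  · exact div_nonneg (Real.rpow_nonneg hW.le _) (by linarith)

/-- The norm of `t ↦ t^(-θ) K(t)` in `L²(dt / t)`, for a function `K` on `(0, ∞)`. -/
noncomputable def interpENorm (θ : ℝ) (K : ℝ → ℝ≥0∞) : ℝ≥0∞ :=
  (∫⁻ t in Set.Ioi (0 : ℝ),
    (ENNReal.ofReal (t ^ (-θ)) * K t) ^ (2 : ℝ) * ENNReal.ofReal t⁻¹) ^ (1 / (2 : ℝ))

lemma realInterpENorm_two_eq {V : Type*} [AddCommGroup V] (N₀ N₁ : V → ℝ≥0∞) (θ : ℝ) (u : V) :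
    realInterpENorm N₀ N₁ θ 2 u = interpENorm θ fun t => kFunctional N₁ N₀ t u := rfl

lemma interpENorm_mono {θ : ℝ} {K L : ℝ → ℝ≥0∞} (h : ∀ t, 0 < t → K t ≤ L t) :
    interpENorm θ K ≤ interpENorm θ L := by
  refine ENNReal.rpow_le_rpow (setLIntegral_mono' measurableSet_Ioi fun t ht => ?_) (by norm_num)
  exact mul_le_mul_left (ENNReal.rpow_le_rpow (mul_le_mul_right (h t ht) _) (by norm_num)) _

lemma interpENorm_const_mul {θ : ℝ} {c : ℝ≥0∞} (hc : c ≠ ∞) (K : ℝ → ℝ≥0∞) :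
    interpENorm θ (fun t => c * K t) = c * interpENorm θ K := by
  unfold interpENorm
  have h : ∀ t : ℝ, (ENNReal.ofReal (t ^ (-θ)) * (c * K t)) ^ (2 : ℝ) * ENNReal.ofReal t⁻¹ =
      c ^ (2 : ℝ) * ((ENNReal.ofReal (t ^ (-θ)) * K t) ^ (2 : ℝ) * ENNReal.ofReal t⁻¹) := fun t => by
    rw [mul_left_comm, ENNReal.mul_rpow_of_nonneg c _ (by norm_num), mul_assoc]
  simp only [h]
  rw [lintegral_const_mul' _ _ (ENNReal.rpow_ne_top_of_nonneg (by norm_num) hc),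
    ENNReal.mul_rpow_of_nonneg _ _ (by norm_num), ← ENNReal.rpow_mul]
  norm_num

lemma interpENorm_add_le {θ : ℝ} {K L : ℝ → ℝ≥0∞} (hK : Measurable K) (hL : Measurable L) :
    interpENorm θ (fun t => K t + L t) ≤ interpENorm θ K + interpENorm θ L := by
  -- Absorbing the square root of `1/t` into the integrand gives an ordinary `L²` norm, to which
  -- Minkowski applies.
  have e : ∀ M : ℝ → ℝ≥0∞, interpENorm θ M = (∫⁻ t in Set.Ioi (0 : ℝ),
      (ENNReal.ofReal (t ^ (-θ)) * ENNReal.ofReal t⁻¹ ^ (1 / (2 : ℝ)) * M t) ^ (2 : ℝ)) ^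
        (1 / (2 : ℝ)) := fun M => by
    unfold interpENorm
    congr 1
    refine lintegral_congr fun t => ?_
    rw [mul_right_comm, ENNReal.mul_rpow_of_nonneg _ (ENNReal.ofReal t⁻¹ ^ _) (by norm_num),
      ← ENNReal.rpow_mul]
    norm_num
  simp only [e, mul_add]
  exact ENNReal.lintegral_Lp_add_le (Measurable.aemeasurable (by fun_prop))
    (Measurable.aemeasurable (by fun_prop)) (by norm_num)

lemma measurable_truncENorm_integrand (s : ℝ) {g : ℝ → ℂ} (hg : Measurable g) :
    Measurable fun z : ℝ × ℝ =>
      (ENNReal.ofReal (min 1 (z.1 * japaneseBracket z.2 ^ s)) * ‖g z.2‖ₑ) ^ (2 : ℝ) := by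
  have h := continuous_japaneseBracket.measurable
  fun_prop

lemma truncENorm_sq (s : ℝ) {t : ℝ} (ht : 0 ≤ t) (g : ℝ → ℂ) :
    truncENorm s t g ^ (2 : ℝ) =
      ∫⁻ x, (ENNReal.ofReal (min 1 (t * japaneseBracket x ^ s)) * ‖g x‖ₑ) ^ (2 : ℝ) := by
  rw [truncENorm, eLpNorm_two_sq]
  refine lintegral_congr fun x => ?_
  rw [enorm_smul, Real.enorm_of_nonneg (min_mul_japaneseBracket_rpow_nonneg s ht x)]

lemma measurable_truncENorm (s : ℝ) {g : ℝ → ℂ} (hg : Measurable g) :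
    Measurable fun t => truncENorm s t g := by
  have h : Measurable fun z : ℝ × ℝ =>
      ‖(min 1 (z.1 * japaneseBracket z.2 ^ s)) • g z.2‖ₑ ^ (2 : ℝ) := by
    have h := continuous_japaneseBracket.measurable
    fun_prop
  have e : (fun t => truncENorm s t g) = fun t =>
      (∫⁻ x, ‖(min 1 (t * japaneseBracket x ^ s)) • g x‖ₑ ^ (2 : ℝ)) ^ (1 / (2 : ℝ)) := by
    funext t
    rw [truncENorm, eLpNorm_eq_lintegral_rpow_enorm_toReal (by norm_num) (by norm_num)]
    rfl
  rw [e]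
  exact (Measurable.lintegral_prod_right' h).pow_const _

lemma interpENorm_truncENorm {θ : ℝ} (hθ₀ : 0 < θ) (hθ₁ : θ < 1) (s : ℝ) {g : ℝ → ℂ}
    (hg : Measurable g) :
    interpENorm θ (fun t => truncENorm s t g) =
      ENNReal.ofReal (truncConst θ) ^ (1 / (2 : ℝ)) * eLpNorm g 2 (bracketMeasure (s * θ)) := by
  have hm := measurable_truncENorm_integrand s hg
  have key : ∫⁻ t in Set.Ioi (0 : ℝ),
      (ENNReal.ofReal (t ^ (-θ)) * truncENorm s t g) ^ (2 : ℝ) * ENNReal.ofReal t⁻¹ =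
        ENNReal.ofReal (truncConst θ) * eLpNorm g 2 (bracketMeasure (s * θ)) ^ (2 : ℝ) := by
    calc
      _ = ∫⁻ t in Set.Ioi (0 : ℝ), ∫⁻ x, (ENNReal.ofReal (t ^ (-θ)) ^ (2 : ℝ) *
            ENNReal.ofReal t⁻¹) * (ENNReal.ofReal (min 1 (t * japaneseBracket x ^ s)) *
              ‖g x‖ₑ) ^ (2 : ℝ) := by
          refine setLIntegral_congr_fun measurableSet_Ioi fun t ht => ?_
          rw [ENNReal.mul_rpow_of_nonneg _ _ (by norm_num), truncENorm_sq s (le_of_lt ht),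
            lintegral_const_mul' _ _ (ENNReal.mul_ne_top
              (ENNReal.rpow_ne_top_of_nonneg (by norm_num) ENNReal.ofReal_ne_top)
              ENNReal.ofReal_ne_top), mul_right_comm]
      _ = ∫⁻ x, ∫⁻ t in Set.Ioi (0 : ℝ), (ENNReal.ofReal (t ^ (-θ)) ^ (2 : ℝ) *
            ENNReal.ofReal t⁻¹) * (ENNReal.ofReal (min 1 (t * japaneseBracket x ^ s)) *
              ‖g x‖ₑ) ^ (2 : ℝ) := by
          rw [lintegral_lintegral_swap]
          refine Measurable.aemeasurable (Measurable.mul ?_ hm)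
          fun_prop
      _ = ∫⁻ x, ENNReal.ofReal (truncConst θ) *
            (ENNReal.ofReal (japaneseBracket x ^ (s * θ)) * ‖g x‖ₑ) ^ (2 : ℝ) := by
          refine lintegral_congr fun x => ?_
          have hx := Real.rpow_pos_of_pos (japaneseBracket_pos x) s
          rw [ENNReal.mul_rpow_of_nonneg (ENNReal.ofReal (japaneseBracket x ^ (s * θ))) _
            (by norm_num), ← mul_assoc, Real.rpow_mul (japaneseBracket_pos x).le,
            ← lintegral_rpow_min_sq hθ₀ hθ₁ hx,
            ← lintegral_mul_const' _ _ (ENNReal.rpow_ne_top_of_nonneg (by norm_num) enorm_ne_top)]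
          refine lintegral_congr fun t => ?_
          simp only [ENNReal.mul_rpow_of_nonneg _ _ (zero_le_two (α := ℝ))]
          ring
      _ = _ := by
          rw [lintegral_const_mul' _ _ ENNReal.ofReal_ne_top,
            eLpNorm_bracketMeasure_sq _ _ hg.aestronglyMeasurable]
  rw [interpENorm, key, ENNReal.mul_rpow_of_nonneg _ _ (by norm_num), ← ENNReal.rpow_mul]
  norm_num

/-! ### The `K`-functional of the couple `(L², Σ^{s,r})` -/

lemma kFunctional_le_of_sub {V : Type*} [AddCommGroup V] (N₀ N₁ : V → ℝ≥0∞) (t : ℝ) (u a : V) :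
    kFunctional N₀ N₁ t u ≤ N₀ (u - a) + ENNReal.ofReal t * N₁ a :=
  iInf_le_of_le (u - a) (iInf_le_of_le a (iInf_le_of_le (sub_add_cancel u a).symm le_rfl))

lemma sigmaENorm_zero (s r : ℝ) : sigmaENorm s r 0 = 0 := by
  have h : ∀ s, eLpNorm (0 : L2R) 2 (bracketMeasure s) = 0 := fun s => by
    rw [eLpNorm_congr_ae ((bracketMeasure_absolutelyContinuous s).ae_le (Lp.coeFn_zero ℂ 2 volume)),
      eLpNorm_zero]
  have h0 : (𝓕 (0 : L2R) : L2R) = 0 := map_zero (Lp.fourierTransformₗᵢ ℝ ℂ)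
  rw [sigmaENorm, sobolevENorm, weightedENorm, h0, h, h, add_zero]

/-- Sharp frequency cutoff at height `⟨ξ⟩^s ≤ 1 / t`. -/
lemma exists_frequency_cutoff (s : ℝ) {t : ℝ} (ht : 0 < t) (u : L2R) :
    ∃ v : L2R, ENNReal.ofReal t * sobolevENorm s v ≤ truncENorm s t (𝓕 u : L2R) ∧
      lTwoENorm (u - v) ≤ truncENorm s t (𝓕 u : L2R) := by
  have hS : MeasurableSet {x | t * japaneseBracket x ^ s ≤ 1} :=
    measurableSet_le (continuous_const.mul (continuous_japaneseBracket_rpow s)).measurable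
      measurable_const
  have hb := (Lp.memLp (𝓕 u : L2R)).indicator hS
  refine ⟨𝓕⁻ (hb.toLp _ : L2R), ?_, ?_⟩
  · rw [sobolevENorm, FourierTransform.fourier_fourierInv_eq,
      eLpNorm_bracketMeasure_eq_smul s _ (Lp.aestronglyMeasurable _), ← Real.enorm_of_nonneg ht.le,
      ← eLpNorm_const_smul]
    refine eLpNorm_mono_ae ?_
    filter_upwards [hb.coeFn_toLp] with x hx
    rw [Pi.smul_apply, hx]
    -- The cutoff follows the two branches of the minimum, so both estimates hold with constant `1`.
    by_cases h : t * japaneseBracket x ^ s ≤ 1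
    · rw [Set.indicator_of_mem (by exact h), smul_smul, min_eq_right h]
    · rw [Set.indicator_of_notMem (by exact h), smul_zero, smul_zero, norm_zero]
      exact norm_nonneg _
  · have hsub : (𝓕 (u - 𝓕⁻ (hb.toLp _ : L2R) : L2R) : L2R) = 𝓕 u - hb.toLp _ := by
      conv_rhs => rw [← FourierTransform.fourier_fourierInv_eq (F := L2R) (E := L2R) (hb.toLp _)]
      exact map_sub (Lp.fourierTransformₗᵢ ℝ ℂ) _ _
    rw [← lTwoENorm_fourier, hsub]
    refine eLpNorm_mono_ae ?_
    filter_upwards [hb.coeFn_toLp, Lp.coeFn_sub (𝓕 u : L2R) (hb.toLp _)] with x hx hx'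
    rw [hx', Pi.sub_apply, hx]
    by_cases h : t * japaneseBracket x ^ s ≤ 1
    · rw [Set.indicator_of_mem (by exact h), sub_self, norm_zero]
      exact norm_nonneg _
    · rw [Set.indicator_of_notMem (by exact h), sub_zero, min_eq_left (not_le.1 h).le, one_smul]

/-! ### Spatial cutoff at scale `|x| ~ t^{-1/r}` -/

section Cutoff

variable {r t : ℝ} {p : 𝓢(ℝ, ℂ)}

/-- With `δ = t^{1/r}`, the left side vanishes unless `δ|x| > 1`, and then `t⟨x⟩^r = (δ⟨x⟩)^r ≥ 1`.
-/
lemma norm_one_sub_cutoff_le (hr : 0 < r) (ht : 0 < t) (h1 : ∀ x, |x| ≤ 1 → p x = 1)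
    (h4 : ∀ x, ‖1 - p x‖ ≤ 1) (x : ℝ) :
    ‖1 - p (t ^ (1 / r) * x)‖ ≤ min 1 (t * japaneseBracket x ^ r) := by
  have hδ := Real.rpow_pos_of_pos ht (1 / r)
  by_cases h : |t ^ (1 / r) * x| ≤ 1
  · rw [h1 _ h, sub_self, norm_zero]
    exact min_mul_japaneseBracket_rpow_nonneg r ht.le x
  · refine (h4 _).trans (le_min le_rfl ?_)
    have hx : |x| ≤ japaneseBracket x := by
      rw [← Real.sqrt_sq_eq_abs]
      exact Real.sqrt_le_sqrt (by linarith)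
    have h5 : 1 ≤ t ^ (1 / r) * japaneseBracket x := by
      rw [abs_mul, abs_of_pos hδ] at h
      exact (not_le.1 h).le.trans (mul_le_mul_of_nonneg_left hx hδ.le)
    have h6 := Real.one_le_rpow h5 hr.le
    rwa [Real.mul_rpow hδ.le (japaneseBracket_pos x).le, ← Real.rpow_mul ht.le,
      one_div_mul_cancel hr.ne', Real.rpow_one] at h6

/-- Where the cutoff is nonzero, `δ = t^{1/r} ≤ 1` and `δ|x| < 2` give `δ²⟨x⟩² ≤ 1 + 4`, whence the
constant `√5 ^ r`. -/
lemma mul_japaneseBracket_rpow_mul_norm_cutoff_le (hr : 0 < r) (ht : 0 < t) (ht1 : t ≤ 1)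
    (h2 : ∀ x, 2 ≤ |x| → p x = 0) (h3 : ∀ x, ‖p x‖ ≤ 1) (x : ℝ) :
    t * japaneseBracket x ^ r * ‖p (t ^ (1 / r) * x)‖ ≤
      √5 ^ r * min 1 (t * japaneseBracket x ^ r) := by
  have hδ := Real.rpow_pos_of_pos ht (1 / r)
  have hδ1 : t ^ (1 / r) ≤ 1 := Real.rpow_le_one ht.le ht1 (by positivity)
  have hW : 0 ≤ t * japaneseBracket x ^ r :=
    mul_nonneg ht.le (Real.rpow_nonneg (japaneseBracket_pos x).le _)
  have hC : 1 ≤ √5 ^ r := Real.one_le_rpow (Real.one_le_sqrt.2 (by norm_num)) hr.le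
  by_cases h : 2 ≤ |t ^ (1 / r) * x|
  · rw [h2 _ h, norm_zero, mul_zero]
    exact mul_nonneg (by positivity) (min_mul_japaneseBracket_rpow_nonneg r ht.le x)
  · refine (mul_le_of_le_one_right hW (h3 _)).trans ?_
    rw [mul_min_of_nonneg _ _ (by positivity), mul_one]
    refine le_min ?_ (le_mul_of_one_le_left hW hC)
    have h5 : t ^ (1 / r) * japaneseBracket x ≤ √5 := by
      rw [← Real.sqrt_sq hδ.le, japaneseBracket, ← Real.sqrt_mul (sq_nonneg _)]
      refine Real.sqrt_le_sqrt ?_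
      have h6 : (t ^ (1 / r) * x) ^ 2 ≤ 2 ^ 2 := sq_le_sq.2 (by
        rw [abs_two]; exact (not_le.1 h).le)
      have h7 : (t ^ (1 / r)) ^ 2 ≤ 1 := pow_le_one₀ hδ.le hδ1
      nlinarith
    have h6 := Real.rpow_le_rpow (mul_nonneg hδ.le (japaneseBracket_pos x).le) h5 hr.le
    rwa [Real.mul_rpow hδ.le (japaneseBracket_pos x).le, ← Real.rpow_mul ht.le,
      one_div_mul_cancel hr.ne', Real.rpow_one] at h6

/-- Writing `u - pv = (1 - p)u + p(u - v)` puts the spatial truncation on `u` rather than on `v`,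
whose decay is not controlled. -/
lemma lTwoENorm_sub_cutoff_le (hr : 0 < r) (ht : 0 < t) (h1 : ∀ x, |x| ≤ 1 → p x = 1)
    (h3 : ∀ x, ‖p x‖ ≤ 1) (h4 : ∀ x, ‖1 - p x‖ ≤ 1) {u v a : L2R}
    (ha : a =ᵐ[volume] fun x => p (t ^ (1 / r) * x) * v x) :
    lTwoENorm (u - a) ≤ truncENorm r t u + lTwoENorm (u - v) := by
  have hm : AEStronglyMeasurable (fun x => p (t ^ (1 / r) * x)) volume :=
    (p.continuous.comp (continuous_const.mul continuous_id)).aestronglyMeasurable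
  calc lTwoENorm (u - a)
      = eLpNorm ((fun x => (1 - p (t ^ (1 / r) * x)) * u x) +
          fun x => p (t ^ (1 / r) * x) * (u - v : L2R) x) 2 volume := by
        refine eLpNorm_congr_ae ?_
        filter_upwards [ha, Lp.coeFn_sub u a, Lp.coeFn_sub u v] with x h5 h6 h7
        rw [h6, Pi.add_apply, Pi.sub_apply, h5, h7, Pi.sub_apply]
        ring
    _ ≤ _ := eLpNorm_add_le ((aestronglyMeasurable_const.sub hm).mul (Lp.aestronglyMeasurable _))
        (hm.mul (Lp.aestronglyMeasurable _)) (by norm_num)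
    _ ≤ _ := by
        refine add_le_add (eLpNorm_mono fun x => ?_) (eLpNorm_mono fun x => ?_)
        · rw [norm_mul, norm_smul]
          exact mul_le_mul_of_nonneg_right
            ((norm_one_sub_cutoff_le hr ht h1 h4 x).trans (le_abs_self _)) (norm_nonneg _)
        · rw [norm_mul]
          exact mul_le_of_le_one_left (norm_nonneg _) (h3 _)

/-- Again `v = u - (u - v)`: the truncated weight acts on `u`, and on `u - v` only its uniform bound
is needed. -/
lemma mul_weightedENorm_cutoff_le (hr : 0 < r) (ht : 0 < t) (ht1 : t ≤ 1)
    (h2 : ∀ x, 2 ≤ |x| → p x = 0) (h3 : ∀ x, ‖p x‖ ≤ 1) {u v a : L2R}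
    (ha : a =ᵐ[volume] fun x => p (t ^ (1 / r) * x) * v x) :
    ENNReal.ofReal t * weightedENorm r a ≤
      ENNReal.ofReal (√5 ^ r) * (truncENorm r t u + lTwoENorm (u - v)) := by
  set P : ℝ → ℂ := fun x => (t * japaneseBracket x ^ r) • p (t ^ (1 / r) * x) with hP
  have hm : AEStronglyMeasurable P volume :=
    ((continuous_const.mul (continuous_japaneseBracket_rpow r)).smul
      (p.continuous.comp (continuous_const.mul continuous_id))).aestronglyMeasurable
  have hb : ∀ x, ‖P x‖ ≤ √5 ^ r * min 1 (t * japaneseBracket x ^ r) := fun x => by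
    rw [hP, norm_smul, Real.norm_of_nonneg
      (mul_nonneg ht.le (Real.rpow_nonneg (japaneseBracket_pos x).le _))]
    exact mul_japaneseBracket_rpow_mul_norm_cutoff_le hr ht ht1 h2 h3 x
  clear_value P
  have hC : 0 ≤ √5 ^ r := by positivity
  rw [weightedENorm, eLpNorm_bracketMeasure_eq_smul r a (Lp.aestronglyMeasurable a),
    ← Real.enorm_of_nonneg ht.le, ← eLpNorm_const_smul]
  calc _ = eLpNorm ((fun x => P x * u x) - fun x => P x * (u - v : L2R) x) 2 volume := by
        refine eLpNorm_congr_ae ?_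
        filter_upwards [ha, Lp.coeFn_sub u v] with x h5 h7
        rw [Pi.smul_apply, Pi.sub_apply, h5, h7, Pi.sub_apply, smul_smul, hP]
        simp only [smul_mul_assoc, ← smul_sub]
        congr 1
        ring
    _ ≤ _ := eLpNorm_sub_le (hm.mul (Lp.aestronglyMeasurable _))
        (hm.mul (Lp.aestronglyMeasurable _)) (by norm_num)
    _ ≤ _ := by
        rw [← Real.enorm_of_nonneg hC, mul_add, truncENorm, lTwoENorm, ← eLpNorm_const_smul,
          ← eLpNorm_const_smul]
        refine add_le_add (eLpNorm_mono fun x => ?_) (eLpNorm_mono fun x => ?_)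
        · rw [norm_mul, Pi.smul_apply, smul_smul, norm_smul]
          exact mul_le_mul_of_nonneg_right ((hb x).trans (le_abs_self _)) (norm_nonneg _)
        · rw [norm_mul, Pi.smul_apply, norm_smul, Real.norm_of_nonneg hC]
          exact mul_le_mul_of_nonneg_right
            ((hb x).trans (mul_le_of_le_one_right hC (min_le_left _ _))) (norm_nonneg _)

end Cutoff

lemma kFunctional_sigmaENorm_le {s r : ℝ} (hs : 0 ≤ s) (hr : 0 < r) :
    ∃ C : ℝ≥0, ∀ t : ℝ, 0 < t → ∀ u : L2R,
      kFunctional lTwoENorm (sigmaENorm s r) t u ≤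
        C * (truncENorm s t (𝓕 u : L2R) + truncENorm r t u) := by
  obtain ⟨p, h1, h2, h3, h4⟩ := exists_schwartz_cutoff
  set M := sobolevMulConst s p with hM
  have hMtop : M ≠ ∞ := by rw [hM, sobolevMulConst_eq]; exact ENNReal.ofReal_ne_top
  set D := ENNReal.ofReal (√5 ^ r) with hD
  have hDtop : D ≠ ∞ := ENNReal.ofReal_ne_top
  -- The summands come from `u - a` in `L²`, from `a` in `H^s`, and from `a` in the weighted space.
  refine ⟨(1 + M + D).toNNReal, fun t ht u => ?_⟩
  rw [ENNReal.coe_toNNReal (ENNReal.add_ne_top.2 ⟨ENNReal.add_ne_top.2 ⟨ENNReal.one_ne_top, hMtop⟩,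
    hDtop⟩)]
  set A := truncENorm s t (𝓕 u : L2R)
  set B := truncENorm r t u
  rcases le_or_gt 1 t with ht1 | ht1
  -- For `t ≥ 1` the minimum is identically `1`, and the choice `a = 0` suffices.
  · have hB : lTwoENorm u = B := by
      refine eLpNorm_congr_ae (.of_forall fun x => ?_)
      simp only
      rw [min_eq_left (one_le_mul_of_one_le_of_one_le ht1 (one_le_japaneseBracket_rpow hr.le x)),
        one_smul]
    have h := kFunctional_le_of_sub lTwoENorm (sigmaENorm s r) t u 0
    rw [sub_zero, sigmaENorm_zero, mul_zero, add_zero, hB] at h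
    calc _ ≤ 1 * B := by rwa [one_mul]
      _ ≤ _ := mul_le_mul' (by rw [add_assoc]; exact le_self_add) le_add_self
  · have hδ := Real.rpow_pos_of_pos ht (1 / r)
    have hδ1 : t ^ (1 / r) ≤ 1 := Real.rpow_le_one ht.le ht1.le (by positivity)
    obtain ⟨v, hv1, hv2⟩ := exists_frequency_cutoff s ht u
    have hA : A ≠ ∞ :=
      ((truncENorm_le_eLpNorm s ht.le _).trans_lt (Lp.eLpNorm_lt_top (𝓕 u : L2R))).ne
    have hv : sobolevENorm s v ≠ ∞ := fun h => by
      rw [h, ENNReal.mul_top (by simpa using ht)] at hv1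
      exact hA (top_le_iff.1 hv1)
    have hmem : MemLp (fun x => p (t ^ (1 / r) * x) * v x) 2 volume := by
      refine (Lp.memLp v).of_le (((p.continuous.comp
        (continuous_const.mul continuous_id)).aestronglyMeasurable).mul
          (Lp.aestronglyMeasurable v)) (.of_forall fun x => ?_)
      rw [norm_mul]
      exact mul_le_of_le_one_left (norm_nonneg _) (h3 _)
    have ha := hmem.coeFn_toLp
    have e1 := lTwoENorm_sub_cutoff_le (u := u) hr ht h1 h3 h4 ha
    have e2 := mul_weightedENorm_cutoff_le (u := u) hr ht ht1.le h2 h3 ha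
    have e3 : ENNReal.ofReal t * sobolevENorm s (hmem.toLp _) ≤ M * A := by
      calc _ ≤ ENNReal.ofReal t * (M * sobolevENorm s v) := by
            refine mul_le_mul_right ((sobolevENorm_mul_le hs (schwartzDilation p hδ.ne') ha
              hv).trans ?_) _
            exact mul_le_mul_left (sobolevMulConst_schwartzDilation_le hs p hδ hδ1) _
        _ = M * (ENNReal.ofReal t * sobolevENorm s v) := by ring
        _ ≤ _ := mul_le_mul_right hv1 _
    calc _ ≤ _ := kFunctional_le_of_sub lTwoENorm (sigmaENorm s r) t u (hmem.toLp _)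
      _ ≤ (B + A) + (M * A + D * (B + A)) := by
          rw [sigmaENorm, mul_add]
          exact add_le_add (e1.trans (add_le_add le_rfl hv2))
            (add_le_add e3 (e2.trans (mul_le_mul_right (add_le_add le_rfl hv2) _)))
      _ ≤ (B + A) + (M * (B + A) + D * (B + A)) := by
          gcongr
          exact le_add_self
      _ = _ := by ring

/-! ### Real interpolation between `Σ^{s,r}` and `L²` -/

/-- The factor `2` arises because the K-functional bounds the frequency and the spatial truncation
separately. -/
lemma le_realInterpENorm_sigmaENorm {θ : ℝ} (hθ₀ : 0 < θ) (hθ₁ : θ < 1) (s r : ℝ) (u : L2R) :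
    ENNReal.ofReal (truncConst θ) ^ (1 / (2 : ℝ)) * sigmaENorm (s * θ) (r * θ) u ≤
      2 * realInterpENorm (sigmaENorm s r) lTwoENorm θ 2 u := by
  rw [sigmaENorm, mul_add, two_mul, sobolevENorm, weightedENorm, realInterpENorm_two_eq,
    ← interpENorm_truncENorm hθ₀ hθ₁ s (Lp.stronglyMeasurable _).measurable,
    ← interpENorm_truncENorm hθ₀ hθ₁ r (Lp.stronglyMeasurable _).measurable]
  refine add_le_add (interpENorm_mono fun t ht => ?_) (interpENorm_mono fun t ht => ?_)
  · exact truncENorm_le_kFunctional ht.le (Lp.fourierTransformₗᵢ ℝ ℂ).toLinearEquiv.toLinearMap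
      lTwoENorm_fourier (fun u => le_self_add) u
  · exact truncENorm_le_kFunctional ht.le LinearMap.id (fun _ => rfl) (fun u => le_add_self) u

lemma realInterpENorm_sigmaENorm_le {θ : ℝ} (hθ₀ : 0 < θ) (hθ₁ : θ < 1) {s r : ℝ} (hs : 0 ≤ s)
    (hr : 0 < r) : ∃ C : ℝ≥0, ∀ u : L2R,
      realInterpENorm (sigmaENorm s r) lTwoENorm θ 2 u ≤ C * sigmaENorm (s * θ) (r * θ) u := by
  obtain ⟨C, hC⟩ := kFunctional_sigmaENorm_le hs hr
  refine ⟨C * (truncConst θ).toNNReal ^ (1 / (2 : ℝ)), fun u => ?_⟩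
  have hF : Measurable ((𝓕 u : L2R) : ℝ → ℂ) := (Lp.stronglyMeasurable _).measurable
  have hu : Measurable (u : ℝ → ℂ) := (Lp.stronglyMeasurable _).measurable
  calc _ ≤ interpENorm θ fun t => C * (truncENorm s t (𝓕 u : L2R) + truncENorm r t u) :=
        interpENorm_mono fun t ht => hC t ht u
    _ ≤ C * (interpENorm θ (fun t => truncENorm s t (𝓕 u : L2R)) +
          interpENorm θ fun t => truncENorm r t u) := by
        rw [interpENorm_const_mul ENNReal.coe_ne_top]
        exact mul_le_mul_right
          (interpENorm_add_le (measurable_truncENorm s hF) (measurable_truncENorm r hu)) _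
    _ = _ := by
        rw [interpENorm_truncENorm hθ₀ hθ₁ s hF, interpENorm_truncENorm hθ₀ hθ₁ r hu, ← mul_add,
          ← mul_assoc, ENNReal.coe_mul, ENNReal.coe_rpow_of_nonneg _ (by norm_num)]
        rfl

theorem mainTheorem8 (θ : ℝ) (hθ₀ : 0 < θ) (hθ₁ : θ < 1) (k : ℕ) (r : ℝ) (hr : 0 < r) :
    realInterpSpace (sigmaENorm k r) lTwoENorm θ 2 = sigmaSpace (k * θ) (r * θ) ∧
    ∃ c C : ℝ≥0, 0 < c ∧ 0 < C ∧ ∀ u : L2R,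
      c * sigmaENorm (k * θ) (r * θ) u ≤ realInterpENorm (sigmaENorm k r) lTwoENorm θ 2 u ∧
      realInterpENorm (sigmaENorm k r) lTwoENorm θ 2 u ≤ C * sigmaENorm (k * θ) (r * θ) u := by
  have key : ∃ c C : ℝ≥0, 0 < c ∧ 0 < C ∧ ∀ u : L2R,
      c * sigmaENorm (k * θ) (r * θ) u ≤ realInterpENorm (sigmaENorm k r) lTwoENorm θ 2 u ∧
      realInterpENorm (sigmaENorm k r) lTwoENorm θ 2 u ≤ C * sigmaENorm (k * θ) (r * θ) u := by
    obtain ⟨C, hC⟩ := realInterpENorm_sigmaENorm_le hθ₀ hθ₁ (Nat.cast_nonneg k) hr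
    have hκ : 0 < (truncConst θ).toNNReal := Real.toNNReal_pos.2 (truncConst_pos hθ₀ hθ₁)
    -- Adding `1` to `C` only ensures that it is positive.
    refine ⟨2⁻¹ * (truncConst θ).toNNReal ^ (1 / (2 : ℝ)), C + 1,
      mul_pos (by norm_num) (NNReal.rpow_pos hκ), by positivity, fun u => ⟨?_, ?_⟩⟩
    · have h := mul_le_mul_right (le_realInterpENorm_sigmaENorm hθ₀ hθ₁ k r u) 2⁻¹
      rw [← mul_assoc, ← mul_assoc, ENNReal.inv_mul_cancel (by norm_num) (by norm_num),
        one_mul] at h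
      rw [ENNReal.coe_mul, ENNReal.coe_rpow_of_nonneg _ (by norm_num),
        ENNReal.coe_inv (by norm_num)]
      exact h
    · refine (hC u).trans (mul_le_mul_left ?_ _)
      rw [ENNReal.coe_add]
      exact le_self_add
  refine ⟨?_, key⟩
  obtain ⟨c, C, hc, -, h⟩ := key
  ext u
  rw [mem_sigmaSpace_iff, realInterpSpace, Set.mem_ofPred_eq]
  refine ⟨fun hu => ?_, fun hu => (h u).2.trans_lt (ENNReal.mul_lt_top ENNReal.coe_lt_top hu)⟩
  exact ENNReal.lt_top_of_mul_ne_top_right ((h u).1.trans_lt hu).ne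
    (ENNReal.coe_ne_zero.2 hc.ne')
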